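/- Let $n\ge 1$. For a binary sequence $x=x_1\cdots x_n\in\{0,1\}^n$ put $\mathrm{VT}^0(x)=\sum_{i=1}^n x_i$ and $\mathrm{VT}^k(x)=\sum_{i=1}^n\sum_{j=1}^i j^{k-1}x_i$ for $k\ge 1$. Let $\mathcal B(x)\subseteq\{0,1\}^{n-1}$ be the single-deletion single-substitution ball of $x$: the set of all sequences obtained from $x$ by deleting exactly one entry and then changing at most one entry. A set $\mathcal C\subseteq\{0,1\}^n$ is an $(n,N;\mathcal B)$-reconstruction code if $|\mathcal B(x)\cap\mathcal B(y)|<N$ for any two distinct $x,y\in\mathcal C$; the redundancy of a nonempty $\mathcal C$ is $n-\log_2|\mathcal C|$. For integers $0\le s_0\le 3$, $0\le s_1\le 2n-1$ and $0\le s_2\le 2n^2-1$ let $$\mathcal C_L=\big\{x\in\{0,1\}^n:\ \mathrm{VT}^0(x)\equiv s_0\pmod 4,\ \ \mathrm{VT}^k(x)\equiv s_k\pmod{2n^k}\text{ for }k=1,2\big\}.$$ Then, for every such choice of $s_0,s_1,s_2$, the code $\mathcal C_L$ is an $(n,5;\mathcal B)$-reconstruction code. Moreover, there is a choice of $s_0,s_1,s_2$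 in these ranges for which $\mathcal C_L$ is nonempty and has redundancy at most $3\log_2 n+4$. -/

import Mathlib

/-- Binary sequences of length `n`, with `false` for `0` and `true` for `1`. The entry at the
(one-based) position `i + 1` of `x` is `x i`. -/
abbrev BinSeq (n : ℕ) : Type := Fin n → Bool

namespace BinSeq

/-- `y` is a subsequence of `x`: it is read off from `x` along strictly increasing positions. -/
def IsSubsequence {m n : ℕ} (y : BinSeq m) (x : BinSeq n) : Prop :=
  ∃ f : Fin m → Fin n, StrictMono f ∧ ∀ i, y i = x (f i)

/-- The single-deletion ball. -/
def deletionBall {n : ℕ} (x : BinSeq n) : Set (BinSeq (n - 1)) :=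
  {y | IsSubsequence y x}

/-- The single-substitution ball. -/
def substitutionBall {n : ℕ} (x : BinSeq n) : Set (BinSeq n) :=
  {y | hammingDist x y ≤ 1}

/-- The single-deletion single-substitution ball: all sequences obtained from `x` by one deletion
followed by one substitution (a substitution may leave the sequence unchanged). -/
def deletionSubstitutionBall {n : ℕ} (x : BinSeq n) : Set (BinSeq (n - 1)) :=
  {z | ∃ y ∈ deletionBall x, z ∈ substitutionBall y}

/-- The number of ones. -/
def weight {n : ℕ} (x : BinSeq n) : ℕ := ∑ i, (x i).toNat

/-- The `k`-th order VT syndrome: the weight for `k = 0`, and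
`∑_{i=1}^n ∑_{j=1}^i j^(k-1) x_i` for `k ≥ 1`. -/
def vtSyndrome {n : ℕ} : ℕ → BinSeq n → ℕ
  | 0, x => weight x
  | k + 1, x => ∑ i : Fin n, ∑ j ∈ Finset.Icc 1 ((i : ℕ) + 1), j ^ k * (x i).toNat

end BinSeq

/-- `C` is an `(n, N; B)`-reconstruction code, where `B` is the single-deletion
single-substitution ball. -/
def IsReconstructionCode (n N : ℕ) (C : Set (BinSeq n)) : Prop :=
  ∀ x ∈ C, ∀ y ∈ C, x ≠ y →
    (x.deletionSubstitutionBall ∩ y.deletionSubstitutionBall).ncard < N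

/-- The redundancy `n - log₂ |C|` of a nonempty code `C` of length `n`. -/
noncomputable def redundancy {n : ℕ} (C : Set (BinSeq n)) : ℝ :=
  (n : ℝ) - Real.logb 2 (C.ncard : ℝ)

/-- The code given by `VT⁰(x) ≡ s₀ (mod 4)` and `VTᵏ(x) ≡ sₖ (mod 2nᵏ)` for `k = 1, 2`. -/
def listDecodableCode (n s₀ s₁ s₂ : ℕ) : Set (BinSeq n) :=
  {x | x.vtSyndrome 0 ≡ s₀ [MOD 4] ∧
       x.vtSyndrome 1 ≡ s₁ [MOD 2 * n ^ 1] ∧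
       x.vtSyndrome 2 ≡ s₂ [MOD 2 * n ^ 2]}

/-!
Let `T` be the difference of the prefix sums of two codewords `x ≠ y`. If `x` and `y` have a common
descendant, then their weights agree and `|T| ≤ 2`, so the congruences force `∑ T k = 0` and
`∑ k * T k = 0`. Hence `T` changes sign at least twice.

A common descendant arises by deleting `x i` and `y j` and substituting one entry of each. This
expresses `T` as the effect of moving an entry from position `i` to position `j`, which alone has
constant sign, plus the jumps caused by the substitutions. Two sign changes are possible only if
the deleted entries agree, the substitutions flip the same bit, and the interval between them lies
strictly inside the move. Then `± T` has sign pattern `+ - +`, the sign gives the direction of the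
move, and the boundary of the negative part gives the positions of the substitutions. So a common
descendant is determined by the deleted bit and the flipped bit, that is, by its weight, which takes
at most four values.

The bound on the redundancy is the pigeonhole principle for the `16 n³` residue triples.
-/

/-! ### Sign patterns of sequences with vanishing moments -/

section SignPatterns

variable {R : Type*} [CommRing R] {n : ℕ} {T : ℕ → R}

/-- The sequence `T` is supported on `[0, n)`, and its moments of order `0` and `1` vanish. -/
structure VanishingMoments (n : ℕ) (T : ℕ → R) : Prop where
  eq_zero_of_le : ∀ k, n ≤ k → T k = 0
  sum_eq_zero : ∑ k ∈ Finset.range n, T k = 0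
  sum_mul_eq_zero : ∑ k ∈ Finset.range n, (k : R) * T k = 0

lemma VanishingMoments.smul (h : VanishingMoments n T) (c : R) : VanishingMoments n (c • T) where
  eq_zero_of_le k hk := by simp [h.eq_zero_of_le k hk]
  sum_eq_zero := by simp [← Finset.mul_sum, h.sum_eq_zero]
  sum_mul_eq_zero := by simp [mul_left_comm _ c, ← Finset.mul_sum, h.sum_mul_eq_zero]

lemma VanishingMoments.neg (h : VanishingMoments n T) : VanishingMoments n (-T) := by
  simpa only [neg_one_smul] using h.smul (-1)

variable [LinearOrder R] [IsStrictOrderedRing R]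

lemma VanishingMoments.eq_zero_of_nonpos_of_nonneg (h : VanishingMoments n T) (c : ℕ)
    (hneg : ∀ k < c, T k ≤ 0) (hpos : ∀ k, c ≤ k → 0 ≤ T k) : T = 0 := by
  -- The weight `2 k + 1 - 2 c` changes sign exactly where `T` does and never vanishes.
  have hterm : ∀ k ∈ Finset.range n, 0 ≤ (2 * (k : R) + 1 - 2 * c) * T k := by
    intro k _
    rcases lt_or_ge k c with hk | hk
    · have hkc : (k : R) + 1 ≤ c := by exact_mod_cast hk
      exact mul_nonneg_of_nonpos_of_nonpos (by linarith) (hneg k hk)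
    · have hck : (c : R) ≤ k := by exact_mod_cast hk
      exact mul_nonneg (by linarith) (hpos k hk)
  have hsum : ∑ k ∈ Finset.range n, (2 * (k : R) + 1 - 2 * c) * T k = 0 := by
    calc ∑ k ∈ Finset.range n, (2 * (k : R) + 1 - 2 * c) * T k
        = 2 * ∑ k ∈ Finset.range n, (k : R) * T k
            + (1 - 2 * c) * ∑ k ∈ Finset.range n, T k := by
          rw [Finset.mul_sum, Finset.mul_sum, ← Finset.sum_add_distrib]
          exact Finset.sum_congr rfl fun k _ => by ring
      _ = 0 := by rw [h.sum_eq_zero, h.sum_mul_eq_zero, mul_zero, mul_zero, add_zero]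
  funext k
  by_cases hk : n ≤ k
  · exact h.eq_zero_of_le k hk
  have hweight : 2 * (k : R) + 1 - 2 * c ≠ 0 := by
    have hodd : (2 * k + 1 : ℤ) - 2 * c ≠ 0 := by omega
    exact_mod_cast (Int.cast_ne_zero (α := R)).2 hodd
  have hprod := (Finset.sum_eq_zero_iff_of_nonneg hterm).1 hsum k (by simpa using hk)
  exact (mul_eq_zero.1 hprod).resolve_left hweight

lemma VanishingMoments.eq_zero_of_nonneg_of_nonpos (h : VanishingMoments n T) (c : ℕ)
    (hpos : ∀ k < c, 0 ≤ T k) (hneg : ∀ k, c ≤ k → T k ≤ 0) : T = 0 :=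
  neg_eq_zero.1 <| h.neg.eq_zero_of_nonpos_of_nonneg c
    (fun k hk => neg_nonpos.2 (hpos k hk)) fun k hk => neg_nonneg.2 (hneg k hk)

lemma VanishingMoments.eq_zero_of_nonneg (h : VanishingMoments n T) (hpos : ∀ k, 0 ≤ T k) :
    T = 0 :=
  h.eq_zero_of_nonpos_of_nonneg 0 (fun k hk => absurd hk k.not_lt_zero) fun k _ => hpos k

/-- The sign pattern `+ - +` with sign changes at `p` and `q`: `T` is nonpositive on `(p, q]` and
nonnegative elsewhere. -/
structure PosNegPos (T : ℕ → R) (p q : ℕ) : Prop where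
  nonpos : ∀ k, p < k → k ≤ q → T k ≤ 0
  nonneg : ∀ k, ¬(p < k ∧ k ≤ q) → 0 ≤ T k

variable {p q p' q' : ℕ}

lemma PosNegPos.exists_pos_left (h : PosNegPos T p q) (hT : VanishingMoments n T) (hne : T ≠ 0) :
    ∃ k ≤ p, 0 < T k := by
  contrapose! hne
  refine hT.eq_zero_of_nonpos_of_nonneg (max p q + 1) (fun k hk => ?_)
    fun k hk => h.nonneg k (by omega)
  rcases le_or_gt k p with hkp | hkp
  · exact hne k hkp
  · exact h.nonpos k hkp (by omega)

lemma PosNegPos.exists_pos_right (h : PosNegPos T p q) (hT : VanishingMoments n T) (hne : T ≠ 0) :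
    ∃ k, q < k ∧ 0 < T k := by
  contrapose! hne
  refine hT.eq_zero_of_nonneg_of_nonpos (p + 1) (fun k hk => h.nonneg k (by omega)) fun k hk => ?_
  rcases le_or_gt k q with hkq | hkq
  · exact h.nonpos k (by omega) hkq
  · exact hne k hkq

lemma PosNegPos.exists_neg (h : PosNegPos T p q) (hT : VanishingMoments n T) (hne : T ≠ 0) :
    ∃ k, p < k ∧ k ≤ q ∧ T k < 0 := by
  contrapose! hne
  refine hT.eq_zero_of_nonneg fun k => ?_
  by_cases hk : p < k ∧ k ≤ q
  · exact hne k hk.1 hk.2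
  · exact h.nonneg k hk

lemma PosNegPos.eq_zero_of_neg (h : PosNegPos T p q) (h' : PosNegPos (-T) p' q')
    (hT : VanishingMoments n T) : T = 0 := by
  rcases le_total p p' with hp | hp
  · refine hT.eq_zero_of_nonpos_of_nonneg (max q p' + 1) (fun k hk => ?_)
      fun k hk => h.nonneg k (by omega)
    rcases le_or_gt k p' with hk' | hk'
    · exact neg_nonneg.1 (h'.nonneg k (by omega))
    · exact h.nonpos k (by omega) (by omega)
  · refine hT.eq_zero_of_nonneg_of_nonpos (max q' p + 1) (fun k hk => ?_)
      fun k hk => neg_nonneg.1 (h'.nonneg k (by omega))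
    rcases le_or_gt k p with hk' | hk'
    · exact h.nonneg k (by omega)
    · exact neg_nonpos.1 (h'.nonpos k (by omega) (by omega))

end SignPatterns

/-! ### Deletions and substitutions in integer sequences -/

/-- The partial sum of the first `k` terms of a sequence. -/
def prefixSum {M : Type*} [AddCommMonoid M] (x : ℕ → M) (k : ℕ) : M := ∑ l ∈ Finset.range k, x l

/-- The sequence obtained from `x` by deleting the entry at position `i`. -/
def deleteAt {M : Type*} (x : ℕ → M) (i k : ℕ) : M := if k < i then x k else x (k + 1)

section PrefixSum

variable {M : Type*} [AddCommMonoid M]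

lemma prefixSum_succ (x : ℕ → M) (k : ℕ) : prefixSum x (k + 1) = prefixSum x k + x k :=
  Finset.sum_range_succ x k

lemma prefixSum_add_single (x : ℕ → M) (s : ℕ) (a : M) (k : ℕ) :
    prefixSum (x + Pi.single s a) k = prefixSum x k + if s < k then a else 0 := by
  simp only [prefixSum, Pi.add_apply, Finset.sum_add_distrib, Finset.sum_pi_single',
    Finset.mem_range]

lemma prefixSum_injective {G : Type*} [AddCommGroup G] :
    Function.Injective (prefixSum : (ℕ → G) → ℕ → G) := by
  intro x y h
  funext k
  have hk := congrFun h (k + 1)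
  rwa [prefixSum_succ, prefixSum_succ, congrFun h k, add_right_inj] at hk

lemma prefixSum_deleteAt_of_le (x : ℕ → M) {i k : ℕ} (hk : k ≤ i) :
    prefixSum (deleteAt x i) k = prefixSum x k :=
  Finset.sum_congr rfl fun _ hl => if_pos ((Finset.mem_range.1 hl).trans_le hk)

lemma prefixSum_deleteAt_add (x : ℕ → M) {i k : ℕ} (hk : i ≤ k) :
    prefixSum (deleteAt x i) k + x i = prefixSum x (k + 1) := by
  induction k, hk using Nat.le_induction with
  | base => rw [prefixSum_deleteAt_of_le x le_rfl, prefixSum_succ]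
  | succ k hk ih =>
    rw [prefixSum_succ, add_right_comm, ih, prefixSum_succ x (k + 1), deleteAt, if_neg hk.not_gt]

end PrefixSum

lemma deleteAt_eq_of_const {M : Type*} {y : ℕ → M} {j j' : ℕ} (hle : j ≤ j')
    (hconst : ∀ k, j ≤ k → k ≤ j' → y k = y j') : deleteAt y j = deleteAt y j' := by
  funext k
  unfold deleteAt
  split_ifs with h h'
  · rfl
  · omega
  · rw [hconst k (by omega) (by omega), hconst (k + 1) (by omega) (by omega)]
  · rfl

/-- The sequence `z` arises from `x` by deleting the entry at position `i` and then subtracting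
`α ∈ {-1, 0, 1}` from the entry at position `s`. -/
structure IsDelSub (x z : ℕ → ℤ) (i s : ℕ) (α : ℤ) : Prop where
  abs_le_one : |α| ≤ 1
  deleteAt_eq : deleteAt x i = z + Pi.single s α

/-- All entries are `0` or `1`. -/
def IsBinary (x : ℕ → ℤ) : Prop := ∀ k, x k = 0 ∨ x k = 1

/-- The position, before the deletion of entry `i`, of entry `s` of the shortened sequence. -/
def liftPos (i s : ℕ) : ℕ := if s < i then s else s + 1

section DelSub

variable {x y z : ℕ → ℤ} {i j s t : ℕ} {α β : ℤ}

lemma IsDelSub.prefixSum_of_le (h : IsDelSub x z i s α) {k : ℕ} (hk : k ≤ i) :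
    prefixSum x k = prefixSum z k + if s < k then α else 0 := by
  rw [← prefixSum_deleteAt_of_le x hk, h.deleteAt_eq, prefixSum_add_single]

lemma IsDelSub.prefixSum_succ_of_le (h : IsDelSub x z i s α) {k : ℕ} (hk : i ≤ k) :
    prefixSum x (k + 1) = prefixSum z k + (if s < k then α else 0) + x i := by
  rw [← prefixSum_deleteAt_add x hk, h.deleteAt_eq, prefixSum_add_single]

lemma liftPos_lt_iff_of_le {k : ℕ} (hk : k ≤ i) : liftPos i s < k ↔ s < k := by
  unfold liftPos; split_ifs <;> omega

lemma liftPos_lt_succ_iff_of_le {k : ℕ} (hk : i ≤ k) : liftPos i s < k + 1 ↔ s < k := by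
  unfold liftPos; split_ifs <;> omega

lemma liftPos_eq_succ_of_lt (h : i < liftPos i s) : liftPos i s = s + 1 := by
  unfold liftPos at h ⊢; split_ifs at h ⊢ <;> omega

/-- The first term moves the entry `x i` from position `i` to position `j`; the other three are the
jumps caused by the two substitutions and by `x i ≠ y j`. -/
lemma IsDelSub.prefixSum_sub_prefixSum (hx : IsDelSub x z i s α) (hy : IsDelSub y z j t β)
    (hij : i ≤ j) (k : ℕ) :
    prefixSum x k - prefixSum y k = (if i < k ∧ k ≤ j then x i - y (k - 1) else 0)
      + (if liftPos i s < k then α else 0) - (if liftPos i t < k then β else 0)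
      + if j < k then x i - y j else 0 := by
  rcases le_or_gt k i with hki | hik
  · rw [hx.prefixSum_of_le hki, hy.prefixSum_of_le (hki.trans hij),
      if_neg (by omega : ¬(i < k ∧ k ≤ j)), if_neg (by omega : ¬ j < k)]
    simp only [liftPos_lt_iff_of_le hki]
    ring
  obtain ⟨m, rfl⟩ : ∃ m, k = m + 1 := ⟨k - 1, by omega⟩
  have him : i ≤ m := by omega
  simp only [hx.prefixSum_succ_of_le him, liftPos_lt_succ_iff_of_le him, Nat.add_sub_cancel]
  rcases lt_or_ge m j with hmj | hjm
  · have hym : prefixSum y (m + 1) = prefixSum z m + (if t < m then β else 0) + y m := by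
      rw [prefixSum_succ, hy.prefixSum_of_le hmj.le]
    rw [hym, if_pos (⟨hik, hmj⟩ : i < m + 1 ∧ m + 1 ≤ j), if_neg (by omega : ¬ j < m + 1)]
    ring
  · rw [hy.prefixSum_succ_of_le hjm, if_neg (by omega : ¬(i < m + 1 ∧ m + 1 ≤ j)),
      if_pos (by omega : j < m + 1)]
    ring

lemma IsDelSub.add_eq_add (hx : IsDelSub x z i s α) (hy : IsDelSub y z j t β) {n : ℕ}
    (h : ∀ k, n ≤ k → prefixSum x k = prefixSum y k) : x i + α = y j + β := by
  have hlarge := h (n + i + j + s + t + 1 + 1) (by omega)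
  rw [hx.prefixSum_succ_of_le (by omega), hy.prefixSum_succ_of_le (by omega),
    if_pos (by omega), if_pos (by omega)] at hlarge
  linarith

lemma IsDelSub.abs_prefixSum_sub_le_of_le (hx : IsDelSub x z i s α) (hy : IsDelSub y z j t β)
    (hx01 : IsBinary x) (hy01 : IsBinary y) (heq : x i + α = y j + β) (hij : i ≤ j) (k : ℕ) :
    |prefixSum x k - prefixSum y k| ≤ 2 := by
  have hβ := Int.abs_le_one_iff.1 hy.abs_le_one
  have hxi := hx01 i
  have hyj := hy01 j
  have hyk := hy01 (k - 1)
  rw [hx.prefixSum_sub_prefixSum hy hij, abs_le]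
  split_ifs <;> omega

lemma IsDelSub.abs_prefixSum_sub_le (hx : IsDelSub x z i s α) (hy : IsDelSub y z j t β)
    (hx01 : IsBinary x) (hy01 : IsBinary y) (heq : x i + α = y j + β) (k : ℕ) :
    |prefixSum x k - prefixSum y k| ≤ 2 := by
  rcases le_total i j with hij | hji
  · exact hx.abs_prefixSum_sub_le_of_le hy hx01 hy01 heq hij k
  · rw [abs_sub_comm]
    exact hy.abs_prefixSum_sub_le_of_le hx hy01 hx01 heq.symm hji k

end DelSub

/-! ### Common descendants of two sequences -/

/-- Unless `U` dips below zero strictly inside the support `(i, j]` of `B`, it changes sign at most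
once. -/
lemma VanishingMoments.jumps_mem_Ioo_of_le {n : ℕ} {U B : ℕ → ℤ} {ρ : ℤ} {i j m M : ℕ}
    (hU : VanishingMoments n U) (hne : U ≠ 0) (hB0 : ∀ k, 0 ≤ B k) (hB1 : ∀ k, B k ≤ 1)
    (hB : ∀ k, ¬(i < k ∧ k ≤ j) → B k = 0) (hρ : |ρ| ≤ 1) (hmM : m ≤ M)
    (heq : ∀ k, U k = B k + (if m < k then ρ else 0) - if M < k then ρ else 0) :
    ρ = -1 ∧ i < m ∧ m < M ∧ M < j := by
  have hρ' := Int.abs_le_one_iff.1 hρ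
  have hin : ∀ k, m < k → k ≤ M → U k = B k + ρ := fun k h h' => by
    rw [heq, if_pos h, if_neg (by omega), sub_zero]
  have hout : ∀ k, ¬(m < k ∧ k ≤ M) → U k = B k := fun k h => by
    rw [heq]; split_ifs <;> omega
  have hρ_neg : ρ = -1 := by
    by_contra hρ_ne
    refine hne (hU.eq_zero_of_nonneg fun k => ?_)
    have := hB0 k
    by_cases hk : m < k ∧ k ≤ M
    · rw [hin k hk.1 hk.2]; omega
    · rwa [hout k hk]
  have hpat : PosNegPos U m M :=
    ⟨fun k h h' => by rw [hin k h h', hρ_neg]; linarith [hB1 k],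
      fun k h => by rw [hout k h]; exact hB0 k⟩
  obtain ⟨k₀, hk₀, hpos₀⟩ := hpat.exists_pos_left hU hne
  obtain ⟨k₁, hk₁, hk₁', -⟩ := hpat.exists_neg hU hne
  obtain ⟨k₂, hk₂, hpos₂⟩ := hpat.exists_pos_right hU hne
  have hmem : ∀ k, ¬(m < k ∧ k ≤ M) → 0 < U k → i < k ∧ k ≤ j := fun k h hpos => by
    by_contra hk
    rw [hout k h, hB k hk] at hpos
    exact lt_irrefl 0 hpos
  have h₀ := hmem k₀ (by omega) hpos₀
  have h₂ := hmem k₂ (by omega) hpos₂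
  omega

lemma VanishingMoments.jumps_mem_Ioo {n : ℕ} {U B : ℕ → ℤ} {ρ : ℤ} {i j m M : ℕ}
    (hU : VanishingMoments n U) (hne : U ≠ 0) (hB0 : ∀ k, 0 ≤ B k) (hB1 : ∀ k, B k ≤ 1)
    (hB : ∀ k, ¬(i < k ∧ k ≤ j) → B k = 0) (hρ : |ρ| ≤ 1)
    (heq : ∀ k, U k = B k + (if m < k then ρ else 0) - if M < k then ρ else 0) :
    (ρ = -1 ∧ i < m ∧ m < M ∧ M < j) ∨ (ρ = 1 ∧ i < M ∧ M < m ∧ m < j) := by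
  rcases le_total m M with hmM | hMm
  · exact Or.inl (hU.jumps_mem_Ioo_of_le hne hB0 hB1 hB hρ hmM heq)
  · have hswap := hU.jumps_mem_Ioo_of_le (ρ := -ρ) hne hB0 hB1 hB (by rwa [abs_neg]) hMm
      fun k => by rw [heq k]; split_ifs <;> ring
    omega

/-- Up to sign, `U` is the difference of the prefix sums of two sequences, the second being `y`,
of which the first is obtained by moving the entry `y j` from position `j` to position `i` and
then correcting the prefix sums on `(p, q]` by two substitutions. -/
structure IsCorrectedMove (y U : ℕ → ℤ) (i j p q : ℕ) : Prop where
  lt : p < q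
  eq : ∀ k, U k = (if (i < k ∧ k ≤ j) ∧ y (k - 1) ≠ y j then 1 else 0)
    - if p < k ∧ k ≤ q then 1 else 0

namespace IsCorrectedMove

variable {n : ℕ} {y U : ℕ → ℤ} {i j p q i' j' p' q' : ℕ}

lemma posNegPos (h : IsCorrectedMove y U i j p q) : PosNegPos U p q where
  nonpos k hk hk' := by rw [h.eq, if_pos (⟨hk, hk'⟩ : p < k ∧ k ≤ q)]; split_ifs <;> omega
  nonneg k hk := by rw [h.eq, if_neg hk]; split_ifs <;> omega

lemma mem_of_pos (h : IsCorrectedMove y U i j p q) {k : ℕ} (hk : 0 < U k) :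
    (i < k ∧ k ≤ j) ∧ ¬(p < k ∧ k ≤ q) := by
  rw [h.eq] at hk
  split_ifs at hk <;> omega

/-- Between two points where `U > 0` on either side of the correction, both moves are under way,
so that `U` and `y` alone determine where the correction applies. -/
lemma interval_unique (h : IsCorrectedMove y U i j p q) (h' : IsCorrectedMove y U i' j' p' q')
    (hy : y j = y j') (hU : VanishingMoments n U) (hne : U ≠ 0) :
    p = p' ∧ q = q' ∧ i' < j ∧ i < j' := by
  obtain ⟨k₀, hk₀, hpos₀⟩ := h.posNegPos.exists_pos_left hU hne
  obtain ⟨k₂, hk₂, hpos₂⟩ := h.posNegPos.exists_pos_right hU hne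
  have hi := h.mem_of_pos hpos₀
  have hi' := h'.mem_of_pos hpos₀
  have hj := h.mem_of_pos hpos₂
  have hj' := h'.mem_of_pos hpos₂
  have hlt := h.lt
  have hlt' := h'.lt
  have hiff : ∀ k, k₀ ≤ k → k ≤ k₂ → ((p < k ∧ k ≤ q) ↔ (p' < k ∧ k ≤ q')) := by
    intro k hk hk'
    have heq := (h.eq k).symm.trans (h'.eq k)
    simp only [(by omega : i < k ∧ k ≤ j), (by omega : i' < k ∧ k ≤ j'), hy, true_and,
      and_self, sub_right_inj] at heq
    split_ifs at heq <;> tauto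
  have hp := hiff (p + 1) (by omega) (by omega)
  have hp' := hiff (p' + 1) (by omega) (by omega)
  have hq := hiff q (by omega) (by omega)
  have hq' := hiff q' (by omega) (by omega)
  omega

lemma deleteAt_eq_of_le (h : IsCorrectedMove y U i j p q) (h' : IsCorrectedMove y U i' j' p q)
    (hij : i' < j) (hle : j ≤ j') : deleteAt y j = deleteAt y j' := by
  refine deleteAt_eq_of_const hle fun k hk hk' => ?_
  rcases hk'.eq_or_lt with rfl | hlt
  · rfl
  by_contra hne
  have heq := (h.eq (k + 1)).symm.trans (h'.eq (k + 1))
  rw [if_neg (by omega : ¬((i < k + 1 ∧ k + 1 ≤ j) ∧ y (k + 1 - 1) ≠ y j)),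
    if_pos (⟨by omega, hne⟩ : (i' < k + 1 ∧ k + 1 ≤ j') ∧ y (k + 1 - 1) ≠ y j')] at heq
  omega

lemma deleteAt_eq (h : IsCorrectedMove y U i j p q) (h' : IsCorrectedMove y U i' j' p' q')
    (hy : y j = y j') (hU : VanishingMoments n U) (hne : U ≠ 0) :
    deleteAt y j = deleteAt y j' := by
  obtain ⟨rfl, rfl, hij, hij'⟩ := h.interval_unique h' hy hU hne
  rcases le_total j j' with hle | hle
  · exact h.deleteAt_eq_of_le h' hij hle
  · exact (h'.deleteAt_eq_of_le h hij' hle).symm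

end IsCorrectedMove

/-- Two distinct binary sequences whose syndromes cannot be told apart: the difference of their
prefix sums has vanishing moments. -/
structure IsBalancedPair (n : ℕ) (x y : ℕ → ℤ) : Prop where
  ne : x ≠ y
  left : IsBinary x
  right : IsBinary y
  vanishingMoments : VanishingMoments n (prefixSum x - prefixSum y)

namespace IsBalancedPair

variable {n : ℕ} {x y z w : ℕ → ℤ} {i j s t i' j' s' t' : ℕ} {α β α' β' : ℤ}

lemma symm (h : IsBalancedPair n x y) : IsBalancedPair n y x :=
  ⟨h.ne.symm, h.right, h.left, by simpa only [neg_sub] using h.vanishingMoments.neg⟩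

lemma entry_add_eq (h : IsBalancedPair n x y) (hx : IsDelSub x z i s α)
    (hy : IsDelSub y z j t β) : x i + α = y j + β :=
  hx.add_eq_add hy fun k hk => sub_eq_zero.1 (h.vanishingMoments.eq_zero_of_le k hk)

/-- The difference of the prefix sums, with the sign that makes the moved entry `x i` contribute
positively. -/
def signedDiff (x y : ℕ → ℤ) (i : ℕ) : ℕ → ℤ := (2 * x i - 1) • (prefixSum x - prefixSum y)

lemma signedDiff_ne_zero (h : IsBalancedPair n x y) (i : ℕ) : signedDiff x y i ≠ 0 := by
  have hσ : 2 * x i - 1 ≠ 0 := by omega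
  exact smul_ne_zero hσ (sub_ne_zero.2 (prefixSum_injective.ne h.ne))

lemma vanishingMoments_signedDiff (h : IsBalancedPair n x y) (i : ℕ) :
    VanishingMoments n (signedDiff x y i) :=
  h.vanishingMoments.smul _

lemma signedDiff_apply (h : IsBalancedPair n x y) (hx : IsDelSub x z i s α)
    (hy : IsDelSub y z j t β) (hij : i ≤ j) (k : ℕ) :
    signedDiff x y i k = (if (i < k ∧ k ≤ j) ∧ y (k - 1) ≠ x i then 1 else 0)
      + (if liftPos i s < k then (2 * x i - 1) * α else 0)
      - (if liftPos i t < k then (2 * x i - 1) * β else 0)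
      + if j < k then (2 * x i - 1) * (β - α) else 0 := by
  have hmove : (if (i < k ∧ k ≤ j) ∧ y (k - 1) ≠ x i then (1 : ℤ) else 0)
      = if i < k ∧ k ≤ j then (2 * x i - 1) * (x i - y (k - 1)) else 0 := by
    rw [ite_and]
    rcases h.left i with hxi | hxi <;> rcases h.right (k - 1) with hyk | hyk <;> simp [hxi, hyk]
  have hβα : x i - y j = β - α := by linarith [h.entry_add_eq hx hy]
  rw [signedDiff, Pi.smul_apply, Pi.sub_apply, hx.prefixSum_sub_prefixSum hy hij, hβα, hmove,
    smul_eq_mul]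
  split_ifs <;> ring

/-- A single substitution together with `x i ≠ y j` produces a jump at the far end of the move,
which `VanishingMoments.jumps_mem_Ioo` rules out; so there are two substitutions. -/
lemma entry_eq_and_jumps (h : IsBalancedPair n x y) (hx : IsDelSub x z i s α)
    (hy : IsDelSub y z j t β) (hij : i ≤ j) :
    y j = x i ∧ β = α ∧
      (((2 * x i - 1) * α = -1 ∧ i < liftPos i s ∧ liftPos i s < liftPos i t ∧ liftPos i t < j) ∨
        ((2 * x i - 1) * α = 1 ∧ i < liftPos i t ∧ liftPos i t < liftPos i s ∧
          liftPos i s < j)) := by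
  have hU := h.signedDiff_apply hx hy hij
  have hsum := h.entry_add_eq hx hy
  have hxi := h.left i
  have hyj := h.right j
  have hα := Int.abs_le_one_iff.1 hx.abs_le_one
  have hβ := Int.abs_le_one_iff.1 hy.abs_le_one
  have hσ : |2 * x i - 1| ≤ 1 := by rcases hxi with hxi | hxi <;> simp [hxi]
  have hjumps : ∀ {γ : ℤ} {m M : ℕ}, |γ| ≤ 1 → (∀ k, signedDiff x y i k =
      (if (i < k ∧ k ≤ j) ∧ y (k - 1) ≠ x i then 1 else 0)
        + (if m < k then (2 * x i - 1) * γ else 0) - if M < k then (2 * x i - 1) * γ else 0) →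
      ((2 * x i - 1) * γ = -1 ∧ i < m ∧ m < M ∧ M < j) ∨
        ((2 * x i - 1) * γ = 1 ∧ i < M ∧ M < m ∧ m < j) := fun hγ heq =>
    (h.vanishingMoments_signedDiff i).jumps_mem_Ioo (h.signedDiff_ne_zero i)
      (fun k => by split_ifs <;> norm_num) (fun k => by split_ifs <;> norm_num)
      (fun k hk => if_neg fun hk' => hk hk'.1)
      (by rw [abs_mul]; exact mul_le_one₀ hσ (abs_nonneg _) hγ) heq
  obtain rfl | rfl | hxy : α = 0 ∨ β = 0 ∨ y j = x i := by omega
  · have := hjumps (m := j) (M := liftPos i t) hy.abs_le_one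
      fun k => by rw [hU]; split_ifs <;> ring
    omega
  · have := hjumps (m := liftPos i s) (M := j) hx.abs_le_one
      fun k => by rw [hU]; split_ifs <;> ring
    omega
  · obtain rfl : β = α := by omega
    exact ⟨hxy, rfl, hjumps hx.abs_le_one fun k => by rw [hU]; split_ifs <;> ring⟩

lemma exists_isCorrectedMove (h : IsBalancedPair n x y) (hx : IsDelSub x z i s α)
    (hy : IsDelSub y z j t β) (hij : i ≤ j) :
    y j = x i ∧ β = α ∧
      (((2 * x i - 1) * α = -1 ∧ IsCorrectedMove y (signedDiff x y i) i j (s + 1) (t + 1)) ∨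
        ((2 * x i - 1) * α = 1 ∧ IsCorrectedMove y (signedDiff x y i) i j (t + 1) (s + 1))) := by
  have hU := h.signedDiff_apply hx hy hij
  obtain ⟨hxy, rfl, hshape⟩ := h.entry_eq_and_jumps hx hy hij
  refine ⟨hxy, rfl, hshape.imp ?_ ?_⟩
  · rintro ⟨hσ, hi, hlt, hj⟩
    have hs : liftPos i s = s + 1 := liftPos_eq_succ_of_lt hi
    have ht : liftPos i t = t + 1 := liftPos_eq_succ_of_lt (hi.trans hlt)
    refine ⟨hσ, by omega, fun k => ?_⟩
    rw [hU, hs, ht, hσ, hxy, sub_self, mul_zero]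
    split_ifs <;> omega
  · rintro ⟨hσ, hi, hlt, hj⟩
    have ht : liftPos i t = t + 1 := liftPos_eq_succ_of_lt hi
    have hs : liftPos i s = s + 1 := liftPos_eq_succ_of_lt (hi.trans hlt)
    refine ⟨hσ, by omega, fun k => ?_⟩
    rw [hU, hs, ht, hσ, hxy, sub_self, mul_zero]
    split_ifs <;> omega

lemma entry_eq_of_le (h : IsBalancedPair n x y) (hx : IsDelSub x z i s α)
    (hy : IsDelSub y z j t β) (hij : i ≤ j) : y j = x i ∧ β = α ∧ (α = 1 ∨ α = -1) := by
  obtain ⟨hxy, hβα, hjump⟩ := h.entry_eq_and_jumps hx hy hij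
  refine ⟨hxy, hβα, ?_⟩
  rcases h.left i with hxi | hxi <;> rw [hxi] at hjump <;> omega

lemma entry_eq (h : IsBalancedPair n x y) (hx : IsDelSub x z i s α) (hy : IsDelSub y z j t β) :
    y j = x i ∧ β = α ∧ (α = 1 ∨ α = -1) := by
  rcases le_total i j with hij | hji
  · exact h.entry_eq_of_le hx hy hij
  · obtain ⟨hxy, rfl, hα⟩ := h.symm.entry_eq_of_le hy hx hji
    exact ⟨hxy.symm, rfl, hα⟩

lemma exists_posNegPos (h : IsBalancedPair n x y) (hx : IsDelSub x z i s α)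
    (hy : IsDelSub y z j t β) (hij : i ≤ j) : ∃ p q, PosNegPos (signedDiff x y i) p q := by
  obtain ⟨-, -, ⟨-, hmove⟩ | ⟨-, hmove⟩⟩ := h.exists_isCorrectedMove hx hy hij <;>
    exact ⟨_, _, hmove.posNegPos⟩

/-- Moves of equal entries in opposite directions give the opposite sign patterns `+ - +` and
`- + -`. -/
lemma entry_ne_of_opposite (h : IsBalancedPair n x y) (hx : IsDelSub x z i s α)
    (hy : IsDelSub y z j t β) (hx' : IsDelSub x w i' s' α') (hy' : IsDelSub y w j' t' β')
    (hij : i ≤ j) (hji' : j' ≤ i') : x i ≠ x i' := by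
  intro hxi
  obtain ⟨p, q, hpat⟩ := h.exists_posNegPos hx hy hij
  obtain ⟨p', q', hpat'⟩ := h.symm.exists_posNegPos hy' hx' hji'
  have hneg : signedDiff y x j' = -signedDiff x y i := by
    rw [signedDiff, signedDiff, (h.entry_eq hx' hy').1, hxi, ← smul_neg, neg_sub]
  exact h.signedDiff_ne_zero i
    (hpat.eq_zero_of_neg (hneg ▸ hpat') (h.vanishingMoments_signedDiff i))

lemma eq_of_same_direction (h : IsBalancedPair n x y) (hx : IsDelSub x z i s α)
    (hy : IsDelSub y z j t β) (hx' : IsDelSub x w i' s' α) (hy' : IsDelSub y w j' t' β')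
    (hij : i ≤ j) (hij' : i' ≤ j') (hxi : x i = x i') : z = w := by
  obtain ⟨hyj, rfl, hmove⟩ := h.exists_isCorrectedMove hx hy hij
  obtain ⟨hyj', rfl, hmove'⟩ := h.exists_isCorrectedMove hx' hy' hij'
  have hU := h.vanishingMoments_signedDiff i
  have hne := h.signedDiff_ne_zero i
  have hdiff : signedDiff x y i' = signedDiff x y i := by rw [signedDiff, signedDiff, hxi]
  have hyy : y j = y j' := by omega
  rw [← hxi, hdiff] at hmove'
  obtain ⟨hdel, rfl⟩ : deleteAt y j = deleteAt y j' ∧ t = t' := by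
    rcases hmove with ⟨hσ, hmove⟩ | ⟨hσ, hmove⟩ <;>
      rcases hmove' with ⟨hσ', hmove'⟩ | ⟨hσ', hmove'⟩
    · exact ⟨hmove.deleteAt_eq hmove' hyy hU hne,
        Nat.succ_injective (hmove.interval_unique hmove' hyy hU hne).2.1⟩
    · omega
    · omega
    · exact ⟨hmove.deleteAt_eq hmove' hyy hU hne,
        Nat.succ_injective (hmove.interval_unique hmove' hyy hU hne).1⟩
  rw [hy.deleteAt_eq, hy'.deleteAt_eq] at hdel
  exact add_right_cancel hdel

/-- The sum `x i + α` encodes both the deleted entry and the substitution. -/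
theorem eq_of_entry_add_eq (h : IsBalancedPair n x y) (hx : IsDelSub x z i s α)
    (hy : IsDelSub y z j t β) (hx' : IsDelSub x w i' s' α') (hy' : IsDelSub y w j' t' β')
    (hsum : x i + α = x i' + α') : z = w := by
  obtain ⟨hyj, rfl, hα⟩ := h.entry_eq hx hy
  obtain ⟨hyj', rfl, hα'⟩ := h.entry_eq hx' hy'
  have hbit := h.left i
  have hbit' := h.left i'
  have hxi : x i = x i' := by omega
  obtain rfl := add_left_cancel (hxi ▸ hsum)
  rcases le_total i j with hij | hji <;> rcases le_total i' j' with hij' | hji'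
  · exact h.eq_of_same_direction hx hy hx' hy' hij hij' hxi
  · exact absurd hxi (h.entry_ne_of_opposite hx hy hx' hy' hij hji')
  · exact absurd hxi.symm (h.entry_ne_of_opposite hx' hy' hx hy hij' hji)
  · exact h.symm.eq_of_same_direction hy hx hy' hx' hji hji' (by rw [hyj, hyj', hxi])

end IsBalancedPair

/-! ### Binary sequences as integer sequences -/

lemma exists_eq_succAbove_of_strictMono {m : ℕ} {f : Fin m → Fin (m + 1)} (hf : StrictMono f) :
    ∃ i : Fin (m + 1), f = i.succAbove := by
  have hcard : ((Finset.univ.image f)ᶜ).card = 1 := by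
    rw [Finset.card_compl, Finset.card_image_of_injective _ hf.injective, Finset.card_univ,
      Fintype.card_fin, Fintype.card_fin, Nat.add_sub_cancel_left]
  obtain ⟨i, hi⟩ := Finset.card_eq_one.1 hcard
  refine ⟨i, (hf.range_inj i.strictMono_succAbove).1 ?_⟩
  rw [Fin.range_succAbove, ← Finset.coe_singleton, ← hi, Finset.coe_compl, compl_compl,
    Finset.coe_image, Finset.coe_univ, Set.image_univ]

lemma sum_range_prefixSum_succ_mul {R : Type*} [CommRing R] (c x : ℕ → R) (n : ℕ) :
    ∑ l ∈ Finset.range n, prefixSum c (l + 1) * x l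
      = ∑ k ∈ Finset.range n, c k * (prefixSum x n - prefixSum x k) := by
  induction n with
  | zero => rfl
  | succ n ih =>
    have hshift : ∑ k ∈ Finset.range n, c k * (prefixSum x n + x n - prefixSum x k)
        = ∑ k ∈ Finset.range n, c k * (prefixSum x n - prefixSum x k) + prefixSum c n * x n := by
      simp only [add_sub_right_comm, mul_add, Finset.sum_add_distrib, ← Finset.sum_mul, prefixSum]
    rw [Finset.sum_range_succ, ih, Finset.sum_range_succ, prefixSum_succ x n, prefixSum_succ c n,
      hshift]
    ring

/-- Only `n - 1` terms contribute, so the sum is smaller than `n * B` in absolute value. -/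
lemma sum_eq_zero_of_dvd {f : ℕ → ℤ} {n : ℕ} {B : ℤ} (hB : 0 < B) (h0 : f 0 = 0)
    (hf : ∀ k < n, |f k| ≤ B) (hdvd : n * B ∣ ∑ k ∈ Finset.range n, f k) :
    ∑ k ∈ Finset.range n, f k = 0 := by
  cases n with
  | zero => rfl
  | succ m =>
    refine Int.eq_zero_of_abs_lt_dvd hdvd ?_
    calc |∑ k ∈ Finset.range (m + 1), f k|
        = |∑ k ∈ Finset.range m, f (k + 1)| := by rw [Finset.sum_range_succ', h0, add_zero]
      _ ≤ ∑ k ∈ Finset.range m, |f (k + 1)| := Finset.abs_sum_le_sum_abs _ _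
      _ ≤ m * B := by
          simpa using Finset.sum_le_card_nsmul _ _ B fun k hk =>
            hf (k + 1) (Nat.succ_lt_succ (Finset.mem_range.1 hk))
      _ < (m + 1 : ℕ) * B := by push_cast; linarith

lemma VanishingMoments.of_dvd {T : ℕ → ℤ} {n : ℕ} (hzero : ∀ k, n ≤ k → T k = 0) (h0 : T 0 = 0)
    (hbound : ∀ k, |T k| ≤ 2) (hdvd₀ : 2 * (n : ℤ) ∣ ∑ k ∈ Finset.range n, T k)
    (hdvd₁ : 2 * (n : ℤ) ^ 2 ∣ ∑ k ∈ Finset.range n, ((k : ℤ) + 1) * T k) :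
    VanishingMoments n T := by
  have hsum₀ : ∑ k ∈ Finset.range n, T k = 0 := by
    refine sum_eq_zero_of_dvd two_pos h0 (fun k _ => hbound k) ?_
    rwa [mul_comm]
  have hsum₁ : ∑ k ∈ Finset.range n, ((k : ℤ) + 1) * T k = 0 := by
    rcases n.eq_zero_or_pos with rfl | hn
    · rfl
    refine sum_eq_zero_of_dvd (B := 2 * n) (by positivity) (by rw [h0, mul_zero])
      (fun k hk => ?_) ?_
    · rw [abs_mul, abs_of_nonneg (by positivity), mul_comm]
      exact mul_le_mul (hbound k) (by exact_mod_cast hk) (by positivity) two_pos.le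
    · rwa [mul_left_comm, ← sq]
  refine ⟨hzero, hsum₀, ?_⟩
  simpa only [add_mul, one_mul, Finset.sum_add_distrib, hsum₀, add_zero] using hsum₁

namespace BinSeq

variable {m n : ℕ}

/-- The entries of a binary sequence as integers, continued by zeros. -/
def toIntSeq (x : BinSeq n) (k : ℕ) : ℤ := if h : k < n then ((x ⟨k, h⟩).toNat : ℤ) else 0

lemma toIntSeq_val (x : BinSeq n) (i : Fin n) : x.toIntSeq i = (x i).toNat := dif_pos i.isLt

lemma toIntSeq_of_le (x : BinSeq n) {k : ℕ} (hk : n ≤ k) : x.toIntSeq k = 0 := dif_neg hk.not_gt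

lemma isBinary_toIntSeq (x : BinSeq n) : IsBinary x.toIntSeq := by
  intro k
  rcases lt_or_ge k n with hk | hk
  · rw [x.toIntSeq_val ⟨k, hk⟩]
    cases x ⟨k, hk⟩ <;> decide
  · exact Or.inl (x.toIntSeq_of_le hk)

lemma toIntSeq_injective : Function.Injective (toIntSeq : BinSeq n → ℕ → ℤ) := by
  intro x y h
  funext i
  have hi := congrFun h i
  rw [toIntSeq_val, toIntSeq_val, Nat.cast_inj] at hi
  revert hi
  cases x i <;> cases y i <;> decide

lemma prefixSum_toIntSeq (x : BinSeq n) {N : ℕ} (hN : n ≤ N) :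
    prefixSum x.toIntSeq N = x.weight := by
  rw [prefixSum, Finset.eventually_constant_sum (fun k hk => x.toIntSeq_of_le hk) hN,
    Finset.sum_range, weight, Nat.cast_sum]
  exact Finset.sum_congr rfl fun i _ => x.toIntSeq_val i

lemma toIntSeq_comp_succAbove (x : BinSeq (m + 1)) (i : Fin (m + 1)) :
    toIntSeq (x ∘ i.succAbove) = deleteAt x.toIntSeq i := by
  funext k
  rcases lt_or_ge k m with hk | hk
  · rw [toIntSeq_val (x ∘ i.succAbove) ⟨k, hk⟩, Function.comp_apply, ← toIntSeq_val, deleteAt]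
    simp only [Fin.succAbove, Fin.lt_def, Fin.val_castSucc]
    split_ifs <;> rfl
  · rw [toIntSeq_of_le _ hk, deleteAt, if_neg (by omega), toIntSeq_of_le _ (by omega)]

lemma exists_toIntSeq_eq_add_single {y z : BinSeq n} (h : hammingDist y z ≤ 1) :
    ∃ s α, |α| ≤ 1 ∧ y.toIntSeq = z.toIntSeq + Pi.single s α := by
  rcases eq_or_ne y z with rfl | hne
  · exact ⟨0, 0, by norm_num, by simp⟩
  obtain ⟨s, hs⟩ := Function.ne_iff.1 hne
  have hunique : ∀ i, y i ≠ z i → i = s := fun i hi =>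
    Finset.card_le_one.1 h i (by simpa using hi) s (by simpa using hs)
  refine ⟨s, y.toIntSeq s - z.toIntSeq s, ?_, ?_⟩
  · have := y.isBinary_toIntSeq s
    have := z.isBinary_toIntSeq s
    rw [abs_le]
    omega
  · funext k
    rw [Pi.add_apply]
    rcases eq_or_ne k s with rfl | hks
    · rw [Pi.single_eq_same]; ring
    rw [Pi.single_eq_of_ne hks, add_zero]
    rcases lt_or_ge k n with hk | hk
    · have heq : y ⟨k, hk⟩ = z ⟨k, hk⟩ := by
        by_contra hc
        exact hks (congrArg Fin.val (hunique _ hc))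
      rw [y.toIntSeq_val ⟨k, hk⟩, z.toIntSeq_val ⟨k, hk⟩, heq]
    · rw [y.toIntSeq_of_le hk, z.toIntSeq_of_le hk]

lemma exists_isDelSub {x : BinSeq (m + 1)} {z : BinSeq m} (h : z ∈ x.deletionSubstitutionBall) :
    ∃ i s α, IsDelSub x.toIntSeq z.toIntSeq i s α := by
  obtain ⟨y, ⟨f, hf, hyx⟩, hyz⟩ := h
  obtain ⟨i, rfl⟩ := exists_eq_succAbove_of_strictMono hf
  obtain rfl : y = x ∘ i.succAbove := funext hyx
  obtain ⟨s, α, hα, hsub⟩ := exists_toIntSeq_eq_add_single hyz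
  exact ⟨i, s, α, hα, x.toIntSeq_comp_succAbove i ▸ hsub⟩

lemma weight_eq {x : BinSeq (m + 1)} {z : BinSeq m} {i s : ℕ} {α : ℤ}
    (h : IsDelSub x.toIntSeq z.toIntSeq i s α) :
    (x.weight : ℤ) = z.weight + (x.toIntSeq i + α) := by
  have hlarge := h.prefixSum_succ_of_le (k := m + i + s + 1) (by omega)
  rw [prefixSum_toIntSeq x (by omega), prefixSum_toIntSeq z (by omega), if_pos (by omega)]
    at hlarge
  linarith

lemma weight_mem_Icc {x : BinSeq (m + 1)} {z : BinSeq m} (h : z ∈ x.deletionSubstitutionBall) :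
    z.weight ∈ Set.Icc (x.weight - 2) (x.weight + 1) := by
  obtain ⟨i, s, α, hx⟩ := exists_isDelSub h
  have hw := weight_eq hx
  have hxi := x.isBinary_toIntSeq i
  have hα := Int.abs_le_one_iff.1 hx.abs_le_one
  exact ⟨by omega, by omega⟩

lemma vtSyndrome_succ_eq (x : BinSeq n) (r : ℕ) :
    (x.vtSyndrome (r + 1) : ℤ)
      = ∑ k ∈ Finset.range n, ((k : ℤ) + 1) ^ r * (x.weight - prefixSum x.toIntSeq k) := by
  rw [← prefixSum_toIntSeq x le_rfl, ← sum_range_prefixSum_succ_mul, Finset.sum_range, vtSyndrome,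
    Nat.cast_sum]
  refine Finset.sum_congr rfl fun i _ => ?_
  rw [← Finset.sum_mul, Nat.cast_mul, toIntSeq_val, prefixSum, ← Finset.Ico_add_one_right_eq_Icc,
    Finset.sum_Ico_eq_sum_range, Nat.add_sub_cancel]
  push_cast
  simp only [add_comm]

lemma vtSyndrome_succ_sub {x y : BinSeq n} (hw : x.weight = y.weight) (r : ℕ) :
    (y.vtSyndrome (r + 1) : ℤ) - x.vtSyndrome (r + 1)
      = ∑ k ∈ Finset.range n,
          ((k : ℤ) + 1) ^ r * (prefixSum x.toIntSeq - prefixSum y.toIntSeq) k := by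
  rw [vtSyndrome_succ_eq, vtSyndrome_succ_eq, hw, ← Finset.sum_sub_distrib]
  exact Finset.sum_congr rfl fun k _ => by rw [Pi.sub_apply]; ring

lemma vanishingMoments_of_modEq {x y : BinSeq n} (hw : x.weight = y.weight)
    (hbound : ∀ k, |(prefixSum x.toIntSeq - prefixSum y.toIntSeq) k| ≤ 2)
    (h1 : x.vtSyndrome 1 ≡ y.vtSyndrome 1 [MOD 2 * n ^ 1])
    (h2 : x.vtSyndrome 2 ≡ y.vtSyndrome 2 [MOD 2 * n ^ 2]) :
    VanishingMoments n (prefixSum x.toIntSeq - prefixSum y.toIntSeq) := by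
  have hdvd₀ := h1.dvd
  have hdvd₁ := h2.dvd
  rw [vtSyndrome_succ_sub hw] at hdvd₀ hdvd₁
  simp only [pow_zero, one_mul, pow_one, Nat.cast_mul, Nat.cast_pow, Nat.cast_ofNat] at hdvd₀ hdvd₁
  refine .of_dvd (fun k hk => ?_) (by simp [prefixSum]) hbound hdvd₀ hdvd₁
  rw [Pi.sub_apply, prefixSum_toIntSeq x hk, prefixSum_toIntSeq y hk, hw, sub_self]

lemma isBalancedPair_toIntSeq {x y : BinSeq (m + 1)} {z : BinSeq m} (hne : x ≠ y)
    (h0 : x.vtSyndrome 0 ≡ y.vtSyndrome 0 [MOD 4])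
    (h1 : x.vtSyndrome 1 ≡ y.vtSyndrome 1 [MOD 2 * (m + 1) ^ 1])
    (h2 : x.vtSyndrome 2 ≡ y.vtSyndrome 2 [MOD 2 * (m + 1) ^ 2])
    (hx : z ∈ x.deletionSubstitutionBall) (hy : z ∈ y.deletionSubstitutionBall) :
    IsBalancedPair (m + 1) x.toIntSeq y.toIntSeq := by
  obtain ⟨i, s, α, hx⟩ := exists_isDelSub hx
  obtain ⟨j, t, β, hy⟩ := exists_isDelSub hy
  have hwx := weight_eq hx
  have hwy := weight_eq hy
  have hw : x.weight = y.weight := by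
    have hα := Int.abs_le_one_iff.1 hx.abs_le_one
    have hβ := Int.abs_le_one_iff.1 hy.abs_le_one
    have hxi := x.isBinary_toIntSeq i
    have hyj := y.isBinary_toIntSeq j
    have hmod : x.weight % 4 = y.weight % 4 := h0
    omega
  exact ⟨toIntSeq_injective.ne hne, x.isBinary_toIntSeq, y.isBinary_toIntSeq,
    vanishingMoments_of_modEq hw (hx.abs_prefixSum_sub_le hy x.isBinary_toIntSeq
      y.isBinary_toIntSeq (by omega)) h1 h2⟩

lemma eq_of_weight_eq {x y : BinSeq (m + 1)} {z w : BinSeq m}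
    (h : IsBalancedPair (m + 1) x.toIntSeq y.toIntSeq)
    (hz : z ∈ x.deletionSubstitutionBall ∩ y.deletionSubstitutionBall)
    (hw : w ∈ x.deletionSubstitutionBall ∩ y.deletionSubstitutionBall)
    (hzw : z.weight = w.weight) : z = w := by
  obtain ⟨i, s, α, hx⟩ := exists_isDelSub hz.1
  obtain ⟨j, t, β, hy⟩ := exists_isDelSub hz.2
  obtain ⟨i', s', α', hx'⟩ := exists_isDelSub hw.1
  obtain ⟨j', t', β', hy'⟩ := exists_isDelSub hw.2
  have hwz := weight_eq hx
  have hww := weight_eq hx'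
  exact toIntSeq_injective (h.eq_of_entry_add_eq hx hy hx' hy' (by omega))

end BinSeq

/-! ### The code and its redundancy -/

theorem isReconstructionCode_listDecodableCode (n s₀ s₁ s₂ : ℕ) :
    IsReconstructionCode n 5 (listDecodableCode n s₀ s₁ s₂) := by
  rintro x ⟨hx0, hx1, hx2⟩ y ⟨hy0, hy1, hy2⟩ hxy
  obtain _ | m := n
  · exact absurd (Subsingleton.elim x y) hxy
  have hinj : Set.InjOn BinSeq.weight
      (x.deletionSubstitutionBall ∩ y.deletionSubstitutionBall) := fun z hz w hw hzw =>
    BinSeq.eq_of_weight_eq (BinSeq.isBalancedPair_toIntSeq hxy (hx0.trans hy0.symm)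
      (hx1.trans hy1.symm) (hx2.trans hy2.symm) hz.1 hz.2) hz hw hzw
  have hcard := Set.ncard_le_ncard_of_injOn BinSeq.weight
    (fun z hz => BinSeq.weight_mem_Icc hz.1) hinj (Set.finite_Icc _ _)
  rw [← Finset.coe_Icc, Set.ncard_coe_finset, Nat.card_Icc] at hcard
  omega

/-- Pigeonhole: there are `16 n³` residue triples. -/
lemma exists_two_pow_le_mul_ncard_listDecodableCode {n : ℕ} (hn : 1 ≤ n) :
    ∃ s₀ s₁ s₂ : ℕ, s₀ < 4 ∧ s₁ < 2 * n ∧ s₂ < 2 * n ^ 2 ∧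
      (2 : ℝ) ^ n ≤ 2 ^ 4 * n ^ 3 * (listDecodableCode n s₀ s₁ s₂).ncard := by
  classical
  let residues : BinSeq n → ℕ × ℕ × ℕ := fun x =>
    (x.vtSyndrome 0 % 4, x.vtSyndrome 1 % (2 * n ^ 1), x.vtSyndrome 2 % (2 * n ^ 2))
  let triples : Finset (ℕ × ℕ × ℕ) :=
    Finset.range 4 ×ˢ Finset.range (2 * n ^ 1) ×ˢ Finset.range (2 * n ^ 2)
  have hmem : ∀ x ∈ Finset.univ, residues x ∈ triples := fun x _ => by
    simp only [residues, triples, Finset.mem_product, Finset.mem_range]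
    exact ⟨Nat.mod_lt _ (by positivity), Nat.mod_lt _ (by positivity), Nat.mod_lt _ (by positivity)⟩
  have htriples : (triples.card : ℝ) = 2 ^ 4 * n ^ 3 := by
    simp only [triples, Finset.card_product, Finset.card_range]
    push_cast
    ring
  have hcard : triples.card • ((2 : ℝ) ^ n / (2 ^ 4 * n ^ 3))
      ≤ (Finset.univ : Finset (BinSeq n)).card := by
    rw [nsmul_eq_mul, htriples, mul_div_cancel₀ _ (by positivity)]
    simp
  obtain ⟨⟨s₀, s₁, s₂⟩, hs, hfiber⟩ := Finset.exists_le_card_fiber_of_nsmul_le_card_of_maps_to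
    hmem ⟨_, hmem (fun _ => false) (Finset.mem_univ _)⟩ hcard
  simp only [triples, Finset.mem_product, Finset.mem_range] at hs
  have hcode : listDecodableCode n s₀ s₁ s₂
      = ({x | residues x = (s₀, s₁, s₂)} : Finset (BinSeq n)) := by
    ext x
    simp only [listDecodableCode, Set.mem_ofPred_eq, Finset.coe_filter, Finset.mem_univ, true_and,
      residues, Prod.mk.injEq, Nat.ModEq, Nat.mod_eq_of_lt hs.1, Nat.mod_eq_of_lt hs.2.1,
      Nat.mod_eq_of_lt hs.2.2]
  refine ⟨s₀, s₁, s₂, hs.1, by simpa only [pow_one] using hs.2.1, hs.2.2, ?_⟩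
  rw [hcode, Set.ncard_coe_finset]
  exact (div_le_iff₀' (by positivity)).1 hfiber

lemma nonempty_of_two_pow_le_mul_ncard {n : ℕ} {C : Set (BinSeq n)} {a : ℝ}
    (h : 2 ^ n ≤ a * C.ncard) : C.Nonempty := by
  refine Set.nonempty_of_ncard_ne_zero fun hC => ?_
  rw [hC, Nat.cast_zero, mul_zero] at h
  exact h.not_gt (by positivity)

lemma redundancy_le_logb {n : ℕ} {C : Set (BinSeq n)} {a : ℝ} (ha : 0 < a)
    (h : 2 ^ n ≤ a * C.ncard) : redundancy C ≤ Real.logb 2 a := by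
  have hpow : (0 : ℝ) < 2 ^ n := by positivity
  have hC : (0 : ℝ) < C.ncard := pos_of_mul_pos_right (hpow.trans_le h) ha.le
  have hlog := Real.logb_le_logb_of_le one_lt_two hpow h
  rw [Real.logb_mul ha.ne' hC.ne', Real.logb_pow, Real.logb_self_eq_one one_lt_two, mul_one] at hlog
  rw [redundancy]
  linarith

lemma logb_two_pow_four_mul_pow_three {x : ℝ} (hx : x ≠ 0) :
    Real.logb 2 (2 ^ 4 * x ^ 3) = 3 * Real.logb 2 x + 4 := by
  rw [Real.logb_mul (by norm_num) (pow_ne_zero _ hx), Real.logb_pow, Real.logb_pow,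
    Real.logb_self_eq_one one_lt_two]
  push_cast
  ring

theorem theorem8 (n : ℕ) (hn : 1 ≤ n) :
    (∀ s₀ s₁ s₂ : ℕ, s₀ < 4 → s₁ < 2 * n → s₂ < 2 * n ^ 2 →
      IsReconstructionCode n 5 (listDecodableCode n s₀ s₁ s₂)) ∧
    (∃ s₀ s₁ s₂ : ℕ, s₀ < 4 ∧ s₁ < 2 * n ∧ s₂ < 2 * n ^ 2 ∧
      (listDecodableCode n s₀ s₁ s₂).Nonempty ∧
      redundancy (listDecodableCode n s₀ s₁ s₂) ≤ 3 * Real.logb 2 (n : ℝ) + 4) := by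
  refine ⟨fun s₀ s₁ s₂ _ _ _ => isReconstructionCode_listDecodableCode n s₀ s₁ s₂, ?_⟩
  obtain ⟨s₀, s₁, s₂, hs₀, hs₁, hs₂, hlarge⟩ := exists_two_pow_le_mul_ncard_listDecodableCode hn
  have hn0 : (0 : ℝ) < n := by exact_mod_cast hn
  refine ⟨s₀, s₁, s₂, hs₀, hs₁, hs₂, nonempty_of_two_pow_le_mul_ncard hlarge, ?_⟩
  rw [← logb_two_pow_four_mul_pow_three hn0.ne']
  exact redundancy_le_logb (by positivity) hlarge
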